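/- \textbf{Definitions.} Let $M$ be a monoid. For a non-empty finite set $D$, let $\mathrm{Map}(D)$ be the set of all maps $D\to D$ and let $d_D(f,g)=\frac1{|D|}|\{v\in D: f(v)\neq g(v)\}|$ for $f,g\in\mathrm{Map}(D)$. $M$ is \emph{strongly sofic} if for every finite $K\subset M$ there is an integer $\Delta_K\ge 1$ such that for every $\varepsilon>0$ there are a non-empty finite set $D$ and a map $\sigma\colon M\to\mathrm{Map}(D)$ with $\sigma(1_M)=\mathrm{Id}_D$; $d_D(\sigma(k_1k_2),\sigma(k_1)\sigma(k_2))\le\varepsilon$ for all $k_1,k_2\in K$; $d_D(\sigma(k_1),\sigma(k_2))\ge 1-\varepsilon$ for all distinct $k_1,k_2\in K$; and $|\sigma(k)^{-1}(v)|\le\Delta_K$ for all $k\in K$, $v\in D$. A \emph{strong sofic approximation} of $M$ is a net $\Sigma=(D_i,\sigma_i)_{i\in I}$ indexed by a (non-empty) directed set $I$, where $D_i$ is a non-empty finite set and $\sigma_i\colon M\to\mathrm{Map}(D_i)$ is a map, such that $\sigma_i(1_M)=\mathrm{Id}_{D_i}$ for all $i$; $\lim_i d_{D_i}(\sigma_i(m_1m_2),\sigma_i(m_1)\sigma_i(m_2))=0$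 for all $m_1,m_2\in M$; $\lim_i d_{D_i}(\sigma_i(m_1),\sigma_i(m_2))=1$ for all distinct $m_1,m_2\in M$; and for every finite $K\subset M$ there is an integer $\Delta_K\geq 1$ with $|\sigma_i(k)^{-1}(v)|\le\Delta_K$ for all $i\in I$, $k\in K$, $v\in D_i$. An action of $M$ on a topological space $X$ is \emph{continuous} if $x\mapsto mx$ is continuous for every $m\in M$. Let $X$ be a compact topological space with a continuous action of $M$. A \emph{continuous pseudometric} on $X$ is a pseudometric $\rho\colon X\times X\to\mathbb R$ that is continuous on $X\times X$; it is \emph{dynamically generating} for $(X,M)$ if for all distinct $x,y\in X$ there is $m\in M$ with $\rho(mx,my)>0$. For $\varphi,\psi\in X^D$ put $$\rho_2^D(\varphi,\psi)=\Big(\tfrac1{|D|}\sum_{v\in D}\rho(\varphi(v),\psi(v))^2\Big)^{1/2},\qquad \rho_\infty^D(\varphi,\psi)=\max_{v\in D}\rho(\varphi(v),\psi(v)).$$ For a finite $F\subset M$, $\delta>0$ and $\sigma\colon M\to\mathrm{Map}(D)$ let $$\mathrm{Map}(X,M,\rho,F,\delta,\sigma)=\{\varphi\in X^D:\ \rho_2^D(\varphi\circ\sigma(m),m\varphi)\le\delta\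 \text{ for all } m\in F\},$$ where $(m\varphi)(v)=m\varphi(v)$. For a pseudometric $d$ on a set containing $A$, let $N_\varepsilon(A,d)$ be the maximal cardinality of a subset $Z\subset A$ with $d(x,y)\ge\varepsilon$ for all distinct $x,y\in Z$. For a strong sofic approximation $\Sigma=(D_i,\sigma_i)_{i\in I}$ put, with $\log 0=-\infty$, $$h_\Sigma(X,M,\rho)=\sup_{\varepsilon>0}\ \inf_{F\subset M\text{ finite}}\ \inf_{\delta>0}\ \limsup_{i\in I}\frac1{|D_i|}\log N_\varepsilon\big(\mathrm{Map}(X,M,\rho,F,\delta,\sigma_i),\rho_\infty^{D_i}\big)\in[-\infty,\infty].$$ If $(X,M)$ admits a dynamically generating continuous pseudometric, put $h_\Sigma(X,M)=h_\Sigma(X,M,\rho)$ for some such $\rho$; part (2) of the theorem says that the choice of $\rho$ does not matter. $(X,M)$ and $(Y,M)$ are \emph{topologically conjugate} if there is an $M$-equivariant homeomorphism $X\to Y$. \textbf{Theorem.} Let $M$ be an infinite strongly sofic monoid, and let $X$ and $Y$ be compact topological spaces equipped with continuous actions of $M$. Suppose that $(X,M)$ and $(Y,M)$ are topologically conjugate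 and that $(X,M)$ admits a dynamically generating continuous pseudometric. Then: (1) $(Y,M)$ admits a dynamically generating continuous pseudometric. (2) For every strong sofic approximation $\Sigma$ of $M$ one has $h_\Sigma(X,M,\rho)=h_\Sigma(X,M)$ for every dynamically generating continuous pseudometric $\rho$ for $(X,M)$, and $h_\Sigma(Y,M,\rho)=h_\Sigma(Y,M)$ for every dynamically generating continuous pseudometric $\rho$ for $(Y,M)$. (3) For every strong sofic approximation $\Sigma$ of $M$ one has $h_\Sigma(X,M)=h_\Sigma(Y,M)$. -/

import Mathlib

open Filter Topology

universe uM uX uY uI uD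

/-! ### Pseudometrics, separated sets, dynamically generating pseudometrics -/

/-- `ρ : X → X → ℝ` is a pseudometric on the set `X`. -/
structure IsPseudometric {X : Type uX} (ρ : X → X → ℝ) : Prop where
  self_eq_zero : ∀ x, ρ x x = 0
  symmetric : ∀ x y, ρ x y = ρ y x
  triangle : ∀ x y z, ρ x y ≤ ρ x z + ρ z y

/-- `ρ` is a pseudometric on `X` which is continuous as a map `X × X → ℝ`. -/
structure IsContinuousPseudometric {X : Type uX} [TopologicalSpace X] (ρ : X → X → ℝ) : Prop
    extends IsPseudometric ρ where
  continuous : Continuous fun p : X × X => ρ p.1 p.2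

/-- For all distinct points `x, y` of `X` there is `m ∈ M` with `ρ (m x) (m y) > 0`. -/
def IsDynamicallyGenerating (M : Type uM) {X : Type uX} [Monoid M] [MulAction M X]
    (ρ : X → X → ℝ) : Prop :=
  ∀ x y : X, x ≠ y → ∃ m : M, 0 < ρ (m • x) (m • y)

/-- `ρ` is a dynamically generating continuous pseudometric for `(X, M)`. -/
structure IsGenPseudometric (M : Type uM) {X : Type uX} [Monoid M] [TopologicalSpace X]
    [MulAction M X] (ρ : X → X → ℝ) : Prop extends IsContinuousPseudometric ρ where
  generating : IsDynamicallyGenerating M ρ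

/-- `(X, M)` admits a dynamically generating continuous pseudometric. -/
def AdmitsGenPseudometric (M : Type uM) (X : Type uX) [Monoid M] [TopologicalSpace X]
    [MulAction M X] : Prop :=
  ∃ ρ : X → X → ℝ, IsGenPseudometric M ρ

/-- `Z` is `(ρ, ε)`-separated: `ρ x y ≥ ε` for all distinct `x, y ∈ Z`. -/
def IsSeparatedFor {X : Type uX} (ρ : X → X → ℝ) (ε : ℝ) (Z : Set X) : Prop :=
  Z.Pairwise fun x y => ε ≤ ρ x y

/-- The maximal cardinality `N_ε(A, ρ)` of a `(ρ, ε)`-separated subset of `A`. -/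
noncomputable def sepNumber {X : Type uX} (A : Set X) (ρ : X → X → ℝ) (ε : ℝ) : ℕ∞ :=
  ⨆ (Z : Set X) (_ : Z ⊆ A) (_ : IsSeparatedFor ρ ε Z), Z.encard

/-! ### Topological conjugacy -/

/-- There is an `M`-equivariant homeomorphism from `X` onto `Y`. -/
def TopologicallyConjugate (M : Type uM) (X : Type uX) (Y : Type uY) [Monoid M]
    [TopologicalSpace X] [MulAction M X] [TopologicalSpace Y] [MulAction M Y] : Prop :=
  ∃ f : X ≃ₜ Y, ∀ (m : M) (x : X), f (m • x) = m • f x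

/-! ### Strong soficity -/

open Classical in
/-- The normalized Hamming metric on the set of all maps `D → D`. -/
noncomputable def hamDist {D : Type uD} [Fintype D] (f g : D → D) : ℝ :=
  (hammingDist f g : ℝ) / (Fintype.card D : ℝ)

/-- Strongly sofic monoids. -/
def StronglySofic (M : Type uM) [Monoid M] : Prop :=
  ∀ K : Finset M, ∃ Δ : ℕ, 1 ≤ Δ ∧ ∀ ε : ℝ, 0 < ε →
    ∃ (D : Type) (_ : Fintype D) (_ : Nonempty D) (σ : M → D → D),
      σ 1 = id ∧
      (∀ k₁ ∈ K, ∀ k₂ ∈ K, hamDist (σ (k₁ * k₂)) (σ k₁ ∘ σ k₂) ≤ ε) ∧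
      (∀ k₁ ∈ K, ∀ k₂ ∈ K, k₁ ≠ k₂ → 1 - ε ≤ hamDist (σ k₁) (σ k₂)) ∧
      (∀ k ∈ K, ∀ v : D, (σ k ⁻¹' {v}).ncard ≤ Δ)

/-- A family `(D i, σ i)` indexed by `i ∈ I`, where `D i` is a non-empty finite set and
`σ i` is a map from `M` to the set of all maps `D i → D i`. -/
structure SoficNet (M : Type uM) (I : Type uI) where
  D : I → Type uD
  [fintypeD : ∀ i, Fintype (D i)]
  [nonemptyD : ∀ i, Nonempty (D i)]
  σ : ∀ i, M → D i → D i

attribute [instance] SoficNet.fintypeD SoficNet.nonemptyD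

/-- The net `S`, indexed by the directed set `I`, is a strong sofic approximation of `M`. -/
structure SoficNet.IsStrongSoficApproximation {M : Type uM} [Monoid M] {I : Type uI} [Preorder I]
    (S : SoficNet.{uM, uI, uD} M I) : Prop where
  map_one : ∀ i, S.σ i 1 = id
  tendsto_mul : ∀ m₁ m₂ : M,
    Tendsto (fun i => hamDist (S.σ i (m₁ * m₂)) (S.σ i m₁ ∘ S.σ i m₂)) atTop (𝓝 0)
  tendsto_distinct : ∀ m₁ m₂ : M, m₁ ≠ m₂ →
    Tendsto (fun i => hamDist (S.σ i m₁) (S.σ i m₂)) atTop (𝓝 1)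
  fiber_bound : ∀ K : Finset M, ∃ Δ : ℕ, 1 ≤ Δ ∧
    ∀ (i : I), ∀ k ∈ K, ∀ v : S.D i, (S.σ i k ⁻¹' {v}).ncard ≤ Δ

/-! ### Sofic topological entropy -/

/-- The pseudometric `ρ_2^D` on `X^D`. -/
noncomputable def rhoTwo {X : Type uX} (D : Type uD) [Fintype D] (ρ : X → X → ℝ)
    (φ ψ : D → X) : ℝ :=
  Real.sqrt ((1 / (Fintype.card D : ℝ)) * ∑ v, ρ (φ v) (ψ v) ^ 2)

/-- The pseudometric `ρ_∞^D` on `X^D`. -/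
noncomputable def rhoInf {X : Type uX} (D : Type uD) [Fintype D] [Nonempty D] (ρ : X → X → ℝ)
    (φ ψ : D → X) : ℝ :=
  Finset.univ.sup' Finset.univ_nonempty fun v => ρ (φ v) (ψ v)

/-- The set `Map(X, M, ρ, F, δ, σ)` of all `φ : D → X` with
`ρ_2^D (φ ∘ σ(m), m φ) ≤ δ` for all `m ∈ F`. -/
def mapSet {M : Type uM} {X : Type uX} [Monoid M] [MulAction M X] {D : Type uD} [Fintype D]
    (ρ : X → X → ℝ) (F : Finset M) (δ : ℝ) (σ : M → D → D) : Set (D → X) :=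
  {φ | ∀ m ∈ F, rhoTwo D ρ (φ ∘ σ m) (fun v => m • φ v) ≤ δ}

/-- `h_Σ(X, M, ε, ρ, F, δ)`, with `log 0 = -∞`. -/
noncomputable def entropyAux {M : Type uM} {X : Type uX} [Monoid M] [MulAction M X]
    {I : Type uI} [Preorder I] (S : SoficNet.{uM, uI, uD} M I) (ρ : X → X → ℝ)
    (ε : ℝ) (F : Finset M) (δ : ℝ) : EReal :=
  limsup (fun i : I =>
    ENNReal.log (sepNumber (mapSet ρ F δ (S.σ i)) (rhoInf (S.D i) ρ) ε : ENNReal) /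
      (Fintype.card (S.D i) : EReal)) atTop

/-- The sofic topological entropy `h_Σ(X, M, ρ)` with respect to `Σ` and `ρ`. -/
noncomputable def relSoficEntropy {M : Type uM} {X : Type uX} [Monoid M] [MulAction M X]
    {I : Type uI} [Preorder I] (S : SoficNet.{uM, uI, uD} M I) (ρ : X → X → ℝ) : EReal :=
  ⨆ (ε : ℝ) (_ : 0 < ε), ⨅ (F : Finset M), ⨅ (δ : ℝ) (_ : 0 < δ), entropyAux S ρ ε F δ

/-- The sofic topological entropy `h_Σ(X, M) = h_Σ(X, M, ρ)`, where `ρ` is some dynamically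
generating continuous pseudometric for `(X, M)`, whose existence is the argument `hX`. -/
noncomputable def soficEntropy {M : Type uM} {X : Type uX} [Monoid M] [TopologicalSpace X]
    [MulAction M X] {I : Type uI} [Preorder I] (S : SoficNet.{uM, uI, uD} M I)
    (hX : AdmitsGenPseudometric M X) : EReal :=
  relSoficEntropy S hX.choose

/-! ### Continuous pseudometrics on compact spaces -/

namespace IsPseudometric

variable {X : Type uX} {ρ : X → X → ℝ}

/-! Conjugacy invariance is formal once the entropy is known not to depend on `ρ`: pulling a
generating pseudometric back along the conjugacy gives a generating pseudometric with the same
entropy (`IsGenPseudometric.comap`, `relSoficEntropy_comap_equiv`). The substance is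
`relSoficEntropy_le`.

Let `ρ`, `ρ'` both be generating. By compactness, closeness for one along a finite part of the orbit
forces closeness for the other (`exists_finset_lt`). With Markov's inequality and the fibre bound of
a strong sofic approximation, good `ρ`-approximate orbits are therefore `ρ'`-approximate orbits
(`eventually_mapSet_subset`). If two of them are uniformly `ρ'`-close, they are `ρ`-close off a
small proportion of `D`. Recording one of them on that exceptional set costs only a factor `exp (η
|D|)` (`exists_card_small_support_le`, `exists_sepNumber_rhoInf_le`), so the growth rates differ by
at most `η`, which is arbitrary. -/

lemma nonneg (h : IsPseudometric ρ) (x y : X) : 0 ≤ ρ x y := by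
  have h1 := h.triangle x x y
  rw [h.self_eq_zero, h.symmetric y x] at h1
  linarith

end IsPseudometric

lemma IsContinuousPseudometric.exists_bound {X : Type uX} [TopologicalSpace X] [CompactSpace X]
    {ρ : X → X → ℝ} (h : IsContinuousPseudometric ρ) : ∃ C : ℝ, ∀ x y, ρ x y ≤ C := by
  obtain ⟨C, hC⟩ := isCompact_univ.bddAbove_image (h.continuous.continuousOn (s := Set.univ))
  exact ⟨C, fun x y => hC ⟨(x, y), Set.mem_univ _, rfl⟩⟩

/-- A compact space is covered by finitely many sets of small diameter. -/
lemma IsContinuousPseudometric.exists_finite_code {X : Type uX} [TopologicalSpace X]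
    [CompactSpace X] {ρ : X → X → ℝ} (h : IsContinuousPseudometric ρ) {ε : ℝ} (hε : 0 < ε) :
    ∃ (α : Type uX) (_ : Fintype α) (c : X → α), ∀ x y, c x = c y → ρ x y < ε := by
  have hU : ∀ x, {y | ρ x y < ε / 2} ∈ 𝓝 x := fun x => by
    have hc : Continuous fun y => ρ x y := h.continuous.comp (by fun_prop : Continuous (x, ·))
    refine (isOpen_lt hc continuous_const).mem_nhds ?_
    simp only [Set.mem_ofPred_eq, h.self_eq_zero]
    positivity
  obtain ⟨t, -, ht⟩ := isCompact_univ.elim_nhds_subcover _ fun x _ => hU x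
  have hcov : ∀ y, ∃ x : t, ρ x y < ε / 2 := fun y => by
    have hy := ht (Set.mem_univ y)
    simp only [Set.mem_iUnion] at hy
    obtain ⟨x, hx, hxy⟩ := hy
    exact ⟨⟨x, hx⟩, hxy⟩
  choose c hc using hcov
  refine ⟨t, inferInstance, c, fun x y hxy => ?_⟩
  have h1 := hc x
  have h2 := hc y
  rw [hxy, h.symmetric] at h1
  linarith [h.triangle x y (c y)]

/-- Closeness for a dynamically generating pseudometric along a finite part of the orbit implies
closeness for any other continuous pseudometric. -/
lemma IsGenPseudometric.exists_finset_lt {M : Type uM} [Monoid M] {X : Type uX}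
    [TopologicalSpace X] [CompactSpace X] [MulAction M X] [ContinuousConstSMul M X]
    {ρ ρ' : X → X → ℝ} (h' : IsGenPseudometric M ρ') (h : IsContinuousPseudometric ρ)
    {ε : ℝ} (hε : 0 < ε) :
    ∃ (K : Finset M) (κ : ℝ), 0 < κ ∧
      ∀ x y, (∀ k ∈ K, ρ' (k • x) (k • y) < κ) → ρ x y < ε := by
  classical
  have hs : IsCompact {p : X × X | ε ≤ ρ p.1 p.2} :=
    (isClosed_le continuous_const h.continuous).isCompact
  -- A pair with `ε ≤ ρ` is off the diagonal, hence separated by some `m` with margin `1 / (n + 1)`.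
  -- A finite subcover leaves finitely many `m` and a smallest margin, which serves as `κ`.
  obtain ⟨t, ht⟩ := hs.elim_finite_subcover
    (fun a : M × ℕ => {p : X × X | 1 / ((a.2 : ℝ) + 1) < ρ' (a.1 • p.1) (a.1 • p.2)})
    (fun a => isOpen_lt continuous_const (h'.continuous.comp
      (by fun_prop : Continuous fun p : X × X => (a.1 • p.1, a.1 • p.2))))
    (fun p hp => by
      have hne : p.1 ≠ p.2 := by
        intro he
        simp only [Set.mem_ofPred_eq, he, h.self_eq_zero] at hp
        linarith
      obtain ⟨m, hm⟩ := h'.generating _ _ hne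
      obtain ⟨n, hn⟩ := exists_nat_one_div_lt hm
      exact Set.mem_iUnion.2 ⟨(m, n), hn⟩)
  refine ⟨t.image Prod.fst, 1 / (((t.sup Prod.snd : ℕ) : ℝ) + 1), by positivity,
    fun x y hxy => ?_⟩
  by_contra hcon
  have hmem := ht (show (x, y) ∈ {p : X × X | ε ≤ ρ p.1 p.2} from not_lt.1 hcon)
  simp only [Set.mem_iUnion] at hmem
  obtain ⟨a, ha, hlt⟩ := hmem
  have h1 := hxy a.1 (Finset.mem_image_of_mem _ ha)
  have h2 : (a.2 : ℝ) ≤ ((t.sup Prod.snd : ℕ) : ℝ) := by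
    exact_mod_cast Finset.le_sup (f := Prod.snd) ha
  have h3 : 1 / (((t.sup Prod.snd : ℕ) : ℝ) + 1) ≤ 1 / ((a.2 : ℝ) + 1) := by gcongr
  simp only [Set.mem_ofPred_eq] at hlt
  linarith

/-! ### The pseudometrics on `X^D` -/

section Power

variable {X : Type uX} {D : Type uD} [Fintype D] {ρ : X → X → ℝ} {φ ψ : D → X}

lemma rhoInf_lt_iff [Nonempty D] {ε : ℝ} : rhoInf D ρ φ ψ < ε ↔ ∀ v, ρ (φ v) (ψ v) < ε := by
  simp [rhoInf, Finset.sup'_lt_iff]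

lemma rhoInf_comm [Nonempty D] (h : IsPseudometric ρ) : rhoInf D ρ φ ψ = rhoInf D ρ ψ φ := by
  simp only [rhoInf, fun v => h.symmetric (φ v) (ψ v)]

/-- Markov's inequality for `rhoTwo`. -/
lemma card_filter_le_of_rhoTwo_le {δ t s : ℝ} (hδ : 0 ≤ δ) (ht : 0 < t)
    (hs : δ ^ 2 ≤ s * t ^ 2) (h : rhoTwo D ρ φ ψ ≤ δ) :
    ((Finset.univ.filter fun v => t ≤ ρ (φ v) (ψ v)).card : ℝ) ≤ s * Fintype.card D := by
  rcases isEmpty_or_nonempty D with hD | hD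
  · simp
  have hc : (0 : ℝ) < Fintype.card D := by exact_mod_cast Fintype.card_pos
  rw [rhoTwo, Real.sqrt_le_left hδ, one_div, inv_mul_le_iff₀ hc] at h
  have h1 : ((Finset.univ.filter fun v => t ≤ ρ (φ v) (ψ v)).card : ℝ) * t ^ 2 ≤
      ∑ v, ρ (φ v) (ψ v) ^ 2 := by
    rw [← nsmul_eq_mul]
    refine (Finset.card_nsmul_le_sum _ _ _ fun v hv => ?_).trans
      (Finset.sum_le_sum_of_subset_of_nonneg (Finset.subset_univ _) fun _ _ _ => sq_nonneg _)
    exact pow_le_pow_left₀ ht.le (Finset.mem_filter.1 hv).2 2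
  have h2 : ((Finset.univ.filter fun v => t ≤ ρ (φ v) (ψ v)).card : ℝ) * t ^ 2 ≤
      (s * Fintype.card D) * t ^ 2 := by nlinarith
  exact le_of_mul_le_mul_right h2 (by positivity)

/-- Closeness at most points implies closeness for `rhoTwo`. -/
lemma rhoTwo_le_of_card_filter_le (h : IsPseudometric ρ) {C κ s δ : ℝ} (hC : ∀ x y, ρ x y ≤ C)
    (hδ : 0 ≤ δ) (hs : κ ^ 2 + C ^ 2 * s ≤ δ ^ 2)
    (hcard : ((Finset.univ.filter fun v => κ ≤ ρ (φ v) (ψ v)).card : ℝ) ≤ s * Fintype.card D) :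
    rhoTwo D ρ φ ψ ≤ δ := by
  rcases isEmpty_or_nonempty D with hD | hD
  · simpa [rhoTwo] using hδ
  have hc : (0 : ℝ) < Fintype.card D := by exact_mod_cast Fintype.card_pos
  rw [rhoTwo, Real.sqrt_le_left hδ, one_div, inv_mul_le_iff₀ hc]
  have h1 : ∀ v ∈ Finset.univ, ρ (φ v) (ψ v) ^ 2 ≤
      κ ^ 2 + if κ ≤ ρ (φ v) (ψ v) then C ^ 2 else 0 := fun v _ => by
    have h0 := h.nonneg (φ v) (ψ v)
    split_ifs with hv
    · nlinarith [hC (φ v) (ψ v), sq_nonneg κ]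
    · nlinarith
  refine (Finset.sum_le_sum h1).trans ?_
  rw [Finset.sum_add_distrib, ← Finset.sum_filter]
  simp only [Finset.sum_const, nsmul_eq_mul, Finset.card_univ]
  nlinarith [sq_nonneg C]

end Power

/-! ### Counting functions of small support -/

/-- Exponential weighting: with weight `t` per support point, all functions together weigh `(1 + N
t) ^ |D|`, while each function counted weighs at least `t ^ (θ |D|)`. Both `t` and `θ` depend only
on `α` and `η`, not on `D`. -/
lemma exists_card_small_support_le (α : Type uX) [Fintype α] {η : ℝ} (hη : 0 < η) :
    ∃ θ : ℝ, 0 < θ ∧ ∀ (D : Type uD) [Fintype D] [DecidableEq D],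
      ((Finset.univ.filter fun f : D → Option α =>
        ((Finset.univ.filter fun v => (f v).isSome).card : ℝ) ≤ θ * Fintype.card D).card : ℝ) ≤
        Real.exp (η * Fintype.card D) := by
  set N : ℝ := ((Fintype.card α : ℕ) : ℝ) with hN
  have hN0 : 0 ≤ N := by positivity
  set t : ℝ := min 1 (η / (2 * (N + 1))) with ht
  have ht0 : 0 < t := by positivity
  have hNt : N * t ≤ η / 2 := by
    have h1 : t ≤ η / (2 * (N + 1)) := min_le_right _ _
    rw [le_div_iff₀ (by positivity)] at h1
    nlinarith
  have hlog : Real.log t ≤ 0 := Real.log_nonpos ht0.le (min_le_left _ _)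
  -- The summand `1` keeps the denominator positive when `t = 1`.
  set θ : ℝ := η / (2 * (1 - Real.log t)) with hθ
  have hθ0 : 0 < θ := by
    have : 0 < 1 - Real.log t := by linarith
    positivity
  have hθt : -(θ * Real.log t) ≤ η / 2 := by
    have h0 : 0 < 1 - Real.log t := by linarith
    have h1 : θ * (1 - Real.log t) = η / 2 := by rw [hθ]; field_simp
    nlinarith
  refine ⟨θ, hθ0, fun D _ _ => ?_⟩
  set n : ℝ := ((Fintype.card D : ℕ) : ℝ) with hn
  have hn0 : 0 ≤ n := by positivity
  set w : Option α → ℝ := fun a => if a.isSome then t else 1 with hw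
  have hsum : ∑ f : D → Option α, ∏ v, w (f v) = (1 + N * t) ^ Fintype.card D := by
    rw [← Fintype.prod_sum fun (_ : D) a => w a]
    simp [hw, Fintype.sum_option, hN]
  have hle : ∀ f ∈ Finset.univ.filter fun f : D → Option α =>
      ((Finset.univ.filter fun v => (f v).isSome).card : ℝ) ≤ θ * n,
      Real.exp (θ * n * Real.log t) ≤ ∏ v, w (f v) := fun f hf => by
    have h1 : ∏ v, w (f v) = t ^ (Finset.univ.filter fun v => (f v).isSome).card := by
      simp [hw, Finset.prod_ite]
    rw [h1, ← Real.rpow_natCast, Real.rpow_def_of_pos ht0, Real.exp_le_exp, mul_comm]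
    exact mul_le_mul_of_nonpos_left (Finset.mem_filter.1 hf).2 hlog
  have h2 := (Finset.card_nsmul_le_sum _ _ _ hle).trans
    (Finset.sum_le_sum_of_subset_of_nonneg (Finset.subset_univ _) fun f _ _ =>
      Finset.prod_nonneg fun v _ => by
        simp only [hw]; split_ifs <;> linarith)
  rw [hsum, nsmul_eq_mul] at h2
  have h3 : (1 + N * t) ^ Fintype.card D ≤ Real.exp (η / 2 * n) := by
    rw [mul_comm (η / 2), hn, Real.exp_nat_mul]
    refine pow_le_pow_left₀ (by positivity) ?_ _
    exact (by linarith [Real.add_one_le_exp (η / 2)])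
  have h4 : Real.exp (η / 2 * n) ≤ Real.exp (η * n) * Real.exp (θ * n * Real.log t) := by
    rw [← Real.exp_add, Real.exp_le_exp]
    nlinarith
  exact le_of_mul_le_mul_right (h2.trans (h3.trans h4)) (Real.exp_pos _)

/-! ### Separated sets -/

section Separated

variable {X : Type uX} {A : Set X} {d d' : X → X → ℝ} {ε ε' : ℝ}

lemma sepNumber_le {R : ℕ∞}
    (h : ∀ Z : Finset X, (Z : Set X) ⊆ A → IsSeparatedFor d ε Z → (Z.card : ℕ∞) ≤ R) :
    sepNumber A d ε ≤ R := by
  refine iSup_le fun Z => iSup_le fun hZA => iSup_le fun hZ => ?_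
  rcases Z.finite_or_infinite with hf | hi
  · have := h hf.toFinset (by simpa using hZA) (by simpa using hZ)
    rwa [hf.encard_eq_coe_toFinset_card]
  · refine le_of_le_of_eq le_top (ENat.eq_top_iff_forall_ge.2 fun n => ?_).symm
    obtain ⟨T, hTZ, rfl⟩ := hi.exists_subset_card_eq n
    exact h T (hTZ.trans hZA) (hZ.mono hTZ)

lemma sepNumber_mono {A' : Set X} (h : A ⊆ A') : sepNumber A d ε ≤ sepNumber A' d ε :=
  iSup_mono fun _ => iSup_mono' fun hZ => ⟨hZ.trans h, le_rfl⟩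

/-- If the `d'`-ball of radius `ε'` around each point of `A` is encoded, up to `d`-distance `ε`,
by the elements of `T`, then separation numbers differ by a factor of at most `T.card`. -/
lemma sepNumber_le_mul {β : Type*} (hself : ∀ x, d' x x < ε') (hsymm : ∀ x y, d' x y = d' y x)
    (code : X → X → β) (T : Finset β)
    (hT : ∀ w ∈ A, ∀ z ∈ A, d' z w < ε' → code w z ∈ T)
    (hcode : ∀ w z z', code w z = code w z' → d z z' < ε) :
    sepNumber A d ε ≤ sepNumber A d' ε' * T.card := by
  classical
  refine sepNumber_le fun Z hZA hZ => ?_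
  -- By maximality, every point of `Z` is within `ε'` of some point of `W`. Sending `z` to such a
  -- point together with the code of `z` relative to it is injective on `Z`.
  obtain ⟨W, hW⟩ := (Z.powerset.filter fun W : Finset X => IsSeparatedFor d' ε' (W : Set X)).exists_maximal
    ⟨∅, Finset.mem_filter.2 ⟨Finset.empty_mem_powerset _, by simp [IsSeparatedFor]⟩⟩
  have hWm := hW.prop
  rw [Finset.mem_filter, Finset.mem_powerset] at hWm
  have hnear : ∀ z, ∃ w, z ∈ Z → w ∈ W ∧ d' z w < ε' := fun z => by
    by_cases hz : z ∈ Z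
    · by_contra! hcon
      have hsep : IsSeparatedFor d' ε' ((insert z W : Finset X) : Set X) := by
        rw [Finset.coe_insert]
        refine Set.pairwise_insert.2 ⟨hWm.2, fun w hw _ => ?_⟩
        exact ⟨(hcon w).2 hw, (hsymm w z).symm ▸ (hcon w).2 hw⟩
      have hle := hW.le_of_ge (Finset.mem_filter.2 ⟨Finset.mem_powerset.2
        (Finset.insert_subset hz hWm.1), hsep⟩) (Finset.subset_insert _ _)
      have hzW : z ∈ W := hle (Finset.mem_insert_self _ _)
      exact absurd (hself z) (not_lt.2 ((hcon z).2 hzW))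
    · exact ⟨z, fun h => absurd h hz⟩
  choose p hp using hnear
  have hcard : Z.card ≤ (W ×ˢ T).card := by
    refine Finset.card_le_card_of_injOn (fun z => (p z, code (p z) z)) (fun z hz => ?_)
      fun z hz z' hz' he => ?_
    · have := hp z hz
      exact Finset.mem_product.2 ⟨this.1, hT _ (hZA (hWm.1 this.1)) _ (hZA hz) this.2⟩
    · rw [Prod.mk.injEq] at he
      by_contra hne
      refine absurd (hZ hz hz' hne) (not_le.2 (hcode (p z) z z' ?_))
      rw [he.2, he.1]
  rw [Finset.card_product] at hcard
  have hWle : (W.card : ℕ∞) ≤ sepNumber A d' ε' := by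
    rw [← Set.encard_coe_eq_coe_finsetCard]
    exact le_iSup_of_le (W : Set X) (le_iSup_of_le ((Finset.coe_subset.2 hWm.1).trans hZA)
      (le_iSup_of_le hWm.2 le_rfl))
  calc (Z.card : ℕ∞) ≤ ((W.card * T.card : ℕ) : ℕ∞) := by exact_mod_cast hcard
    _ = W.card * T.card := by push_cast; rfl
    _ ≤ _ := by gcongr

end Separated

/-- If `ρ'_∞`-close elements of `A` are `ρ`-close off a small proportion of `D`, then the
separation numbers for `ρ` and `ρ'` are comparable up to a factor of small exponential growth. -/
lemma exists_sepNumber_rhoInf_le {X : Type uX} [TopologicalSpace X] [CompactSpace X]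
    {ρ : X → X → ℝ} (h : IsContinuousPseudometric ρ) {ε η : ℝ} (hε : 0 < ε) (hη : 0 < η) :
    ∃ θ : ℝ, 0 < θ ∧ ∀ (D : Type uD) [Fintype D] [Nonempty D] (A : Set (D → X))
      (ρ' : X → X → ℝ) (ε' : ℝ), IsPseudometric ρ' → 0 < ε' →
      (∀ w ∈ A, ∀ z ∈ A, rhoInf D ρ' z w < ε' →
        ((Finset.univ.filter fun v => ε / 2 ≤ ρ (z v) (w v)).card : ℝ) ≤
          θ * Fintype.card D) →
      (sepNumber A (rhoInf D ρ) ε : ENNReal) ≤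
        sepNumber A (rhoInf D ρ') ε' * ENNReal.ofReal (Real.exp (η * Fintype.card D)) := by
  classical
  obtain ⟨α, _, c, hc⟩ := h.exists_finite_code hε
  obtain ⟨θ, hθ, hcount⟩ := exists_card_small_support_le.{uX, uD} α hη
  refine ⟨θ, hθ, fun D _ _ A ρ' ε' h' hε' hA => ?_⟩
  set T := Finset.univ.filter fun f : D → Option α =>
    ((Finset.univ.filter fun v => (f v).isSome).card : ℝ) ≤ θ * Fintype.card D with hT
  have hmul : sepNumber A (rhoInf D ρ) ε ≤ sepNumber A (rhoInf D ρ') ε' * T.card := by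
    refine sepNumber_le_mul (fun x => rhoInf_lt_iff.2 fun v => by rwa [h'.self_eq_zero])
      (fun x y => rhoInf_comm h')
      -- The cell of `z v` is recorded only where `z` is not `ε / 2`-close to the centre `w`. Where
      -- two codes are both `none`, the triangle inequality through `w v` suffices.
      (fun w z v => if ε / 2 ≤ ρ (z v) (w v) then some (c (z v)) else none) T
      (fun w hw z hz hzw => ?_) fun w z z' he => rhoInf_lt_iff.2 fun v => ?_
    · rw [hT, Finset.mem_filter]
      refine ⟨Finset.mem_univ _, le_of_eq_of_le ?_ (hA w hw z hz hzw)⟩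
      congr 2
      ext v
      simp
    · have hev := congrFun he v
      split_ifs at hev with h1 h2 h2
      · exact hc _ _ (Option.some.inj hev)
      · have := h.triangle (z v) (z' v) (w v)
        rw [h.symmetric (w v)] at this
        linarith
  calc (sepNumber A (rhoInf D ρ) ε : ENNReal)
      ≤ ((sepNumber A (rhoInf D ρ') ε' * T.card : ℕ∞) : ENNReal) := by exact_mod_cast hmul
    _ = sepNumber A (rhoInf D ρ') ε' * (T.card : ENNReal) := by simp
    _ ≤ _ := by
      gcongr
      rw [← ENNReal.ofReal_natCast]
      exact ENNReal.ofReal_le_ofReal (hcount D)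

/-! ### Comparison of the spaces of approximate orbits -/

open Classical in
lemma card_filter_ne_le_of_hamDist_le {D : Type uD} [Fintype D] [Nonempty D] {f g : D → D} {r : ℝ}
    (h : hamDist f g ≤ r) :
    ((Finset.univ.filter fun v => f v ≠ g v).card : ℝ) ≤ r * Fintype.card D := by
  have hc : (0 : ℝ) < Fintype.card D := by exact_mod_cast Fintype.card_pos
  rw [hamDist, div_le_iff₀ hc] at h
  exact h

/-- This is where the fibre bound of strong soficity enters: pulling a bad set back along `f`
enlarges it at most `Δ` times. -/
lemma card_filter_comp_le {D : Type uD} [Fintype D] {f : D → D} {Δ : ℕ}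
    (hf : ∀ v, (f ⁻¹' {v}).ncard ≤ Δ) (p : D → Prop) [DecidablePred p] :
    (Finset.univ.filter fun v => p (f v)).card ≤ Δ * (Finset.univ.filter p).card := by
  classical
  refine Finset.card_le_mul_card_image_of_maps_to (f := f) (fun v hv => ?_) Δ fun b _ => ?_
  · simpa using hv
  · refine le_trans ?_ (hf b)
    rw [← Set.ncard_coe_finset]
    exact Set.ncard_le_ncard (fun v hv => by
      have := (Finset.mem_filter.1 hv).2
      exact this) (Set.toFinite _)

lemma Finset.card_biUnion_le_mul_real {ι β : Type*} [DecidableEq β] (K : Finset ι)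
    (E : ι → Finset β) {a : ℝ} (h : ∀ k ∈ K, ((E k).card : ℝ) ≤ a) :
    ((K.biUnion E).card : ℝ) ≤ K.card * a := by
  calc ((K.biUnion E).card : ℝ) ≤ ((∑ k ∈ K, (E k).card : ℕ) : ℝ) := by
        exact_mod_cast Finset.card_biUnion_le
    _ ≤ K.card * a := by
        push_cast
        rw [← nsmul_eq_mul]
        exact Finset.sum_le_card_nsmul _ _ _ h

section ApproximateOrbits

variable {M : Type uM} [Monoid M] {X : Type uX} [MulAction M X]

lemma mapSet_mono {D : Type uD} [Fintype D] {ρ : X → X → ℝ} {F F' : Finset M} {δ δ' : ℝ}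
    {σ : M → D → D} (hF : F' ⊆ F) (hδ : δ ≤ δ') : mapSet ρ F δ σ ⊆ mapSet ρ F' δ' σ :=
  fun _ hφ m hm => (hφ m (hF hm)).trans hδ

/-- For most `v`, `k • φ (σ m v)` is close to `φ (σ k (σ m v)) = φ (σ (k * m) v)`, which is close to
`(k * m) • φ v`. So `φ (σ m v)` and `m • φ v` are `ρ`-close along `K`, hence `ρ'`-close. -/
lemma eventually_mapSet_subset [TopologicalSpace X] [CompactSpace X] [ContinuousConstSMul M X]
    {I : Type uI} [Preorder I] {S : SoficNet.{uM, uI, uD} M I}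
    (hS : S.IsStrongSoficApproximation) {ρ ρ' : X → X → ℝ} (h : IsGenPseudometric M ρ)
    (h' : IsContinuousPseudometric ρ') (F' : Finset M) {δ' : ℝ} (hδ' : 0 < δ') :
    ∃ (F : Finset M) (δ : ℝ), 0 < δ ∧
      ∀ᶠ i in atTop, mapSet ρ F δ (S.σ i) ⊆ mapSet ρ' F' δ' (S.σ i) := by
  classical
  obtain ⟨C, hC⟩ := h'.exists_bound
  obtain ⟨K, τ, hτ, hK⟩ := h.exists_finset_lt h' (half_pos hδ')
  obtain ⟨Δ, -, hΔ⟩ := hS.fiber_bound F'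
  set s : ℝ := δ' ^ 2 / (2 * (C ^ 2 + 1)) with hs
  have hs0 : 0 < s := by positivity
  have hsδ : (δ' / 2) ^ 2 + C ^ 2 * s ≤ δ' ^ 2 := by
    have : s * (2 * (C ^ 2 + 1)) = δ' ^ 2 := by rw [hs]; field_simp
    nlinarith
  -- Each `k` contributes three bad sets: one pulled back along `σ m`, of proportion at most `Δ r`,
  -- and two of proportion at most `r`.
  set r : ℝ := s / ((K.card + 1) * (Δ + 2)) with hr
  have hr0 : 0 < r := by positivity
  have hrs : K.card * ((Δ + 2) * r) ≤ s := by
    have : r * ((K.card + 1) * (Δ + 2)) = s := by rw [hr]; field_simp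
    nlinarith [mul_pos hr0 (by positivity : (0 : ℝ) < Δ + 2)]
  set δ : ℝ := Real.sqrt r * (τ / 2) with hδ
  have hδ0 : 0 < δ := by positivity
  have hδr : δ ^ 2 ≤ r * (τ / 2) ^ 2 := by rw [hδ, mul_pow, Real.sq_sqrt hr0.le]
  have hev : ∀ᶠ i in atTop, ∀ k ∈ K, ∀ m ∈ F',
      hamDist (S.σ i (k * m)) (S.σ i k ∘ S.σ i m) ≤ r := by
    rw [Filter.eventually_all_finset]
    intro k _
    rw [Filter.eventually_all_finset]
    intro m _
    exact (hS.tendsto_mul k m).eventually_le_const hr0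
  refine ⟨K ∪ Finset.image₂ (· * ·) K F', δ, hδ0, hev.mono fun i hi φ hφ m hm => ?_⟩
  refine rhoTwo_le_of_card_filter_le h'.toIsPseudometric hC hδ'.le hsδ ?_
  set σ := S.σ i with hσ
  set n : ℝ := ((Fintype.card (S.D i) : ℕ) : ℝ) with hn
  have hn0 : 0 ≤ n := by positivity
  have hsub : (Finset.univ.filter fun v => δ' / 2 ≤ ρ' ((φ ∘ σ m) v) (m • φ v)) ⊆
      K.biUnion fun k =>
        (Finset.univ.filter fun v => τ / 2 ≤ ρ ((φ ∘ σ k) (σ m v)) (k • φ (σ m v))) ∪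
        ((Finset.univ.filter fun v => σ (k * m) v ≠ (σ k ∘ σ m) v) ∪
        (Finset.univ.filter fun v => τ / 2 ≤ ρ ((φ ∘ σ (k * m)) v) ((k * m) • φ v))) := by
    intro v hv
    by_contra hcon
    refine absurd (Finset.mem_filter.1 hv).2 (not_le.2 (hK _ _ fun k hk => ?_))
    simp only [Finset.mem_biUnion, not_exists, not_and] at hcon
    have := hcon k hk
    simp only [Finset.mem_union, Finset.mem_filter, Finset.mem_univ, true_and, not_or, not_le,
      not_not, Function.comp_apply] at this
    obtain ⟨h1, h2, h3⟩ := this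
    rw [h2, mul_smul] at h3
    rw [h.symmetric] at h1
    have := h.triangle (k • φ (σ m v)) (k • m • φ v) (φ (σ k (σ m v)))
    simp only [Function.comp_apply]
    linarith
  refine (Nat.cast_le.2 (Finset.card_le_card hsub)).trans ?_
  refine (Finset.card_biUnion_le_mul_real K _ (a := (Δ + 2) * r * n) fun k hk => ?_).trans
    (by nlinarith)
  have e1 : ((Finset.univ.filter fun v =>
      τ / 2 ≤ ρ ((φ ∘ σ k) (σ m v)) (k • φ (σ m v))).card : ℝ) ≤ Δ * (r * n) := by
    refine (Nat.cast_le.2 (card_filter_comp_le (hΔ i m hm)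
      fun u => τ / 2 ≤ ρ ((φ ∘ σ k) u) (k • φ u))).trans ?_
    push_cast
    exact mul_le_mul_of_nonneg_left (card_filter_le_of_rhoTwo_le hδ0.le (half_pos hτ) hδr
      (hφ k (Finset.mem_union_left _ hk))) (by positivity)
  have e2 : ((Finset.univ.filter fun v => σ (k * m) v ≠ (σ k ∘ σ m) v).card : ℝ) ≤ r * n := by
    convert card_filter_ne_le_of_hamDist_le (hi k hk m hm)
  have e3 := card_filter_le_of_rhoTwo_le hδ0.le (half_pos hτ) hδr
    (hφ (k * m) (Finset.mem_union_right _ (Finset.mem_image₂_of_mem hk hm)))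
  calc _ ≤ _ + ((_ : ℝ) + _) := by
        refine (Nat.cast_le.2 ((Finset.card_union_le _ _).trans
          (Nat.add_le_add_left (Finset.card_union_le _ _) _))).trans ?_
        push_cast
        exact add_le_add e1 (add_le_add e2 e3)
    _ = (Δ + 2) * r * n := by ring

/-- Approximate orbits that are uniformly `ρ'`-close are `ρ`-close off a small proportion. -/
lemma exists_card_filter_le_of_rhoInf_lt {ρ ρ' : X → X → ℝ} (h' : IsPseudometric ρ') {K : Finset M}
    {κ ε θ : ℝ} (hκ : 0 < κ) (hK : ∀ x y, (∀ k ∈ K, ρ' (k • x) (k • y) < κ) → ρ x y < ε)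
    (hθ : 0 < θ) :
    ∃ δ : ℝ, 0 < δ ∧ ∀ (D : Type uD) [Fintype D] [Nonempty D] (σ : M → D → D),
      ∀ w ∈ mapSet ρ' K δ σ, ∀ z ∈ mapSet ρ' K δ σ, rhoInf D ρ' z w < κ / 3 →
        ((Finset.univ.filter fun v => ε ≤ ρ (z v) (w v)).card : ℝ) ≤ θ * Fintype.card D := by
  classical
  set r : ℝ := θ / (2 * (K.card + 1)) with hr
  have hr0 : 0 < r := by positivity
  have hrθ : K.card * (2 * r) ≤ θ := by
    have : r * (2 * (K.card + 1)) = θ := by rw [hr]; field_simp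
    nlinarith
  set δ : ℝ := Real.sqrt r * (κ / 3) with hδ
  have hδ0 : 0 < δ := by positivity
  have hδr : δ ^ 2 ≤ r * (κ / 3) ^ 2 := by rw [hδ, mul_pow, Real.sq_sqrt hr0.le]
  refine ⟨δ, hδ0, fun D _ _ σ w hw z hz hzw => ?_⟩
  -- The `κ / 3` legs run `k • z v`, `z (σ k v)`, `w (σ k v)`, `k • w v`. The middle one holds at
  -- every `v` because closeness is uniform, so no fibre bound is needed.
  have hsub : (Finset.univ.filter fun v => ε ≤ ρ (z v) (w v)) ⊆
      K.biUnion fun k =>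
        (Finset.univ.filter fun v => κ / 3 ≤ ρ' ((z ∘ σ k) v) (k • z v)) ∪
        (Finset.univ.filter fun v => κ / 3 ≤ ρ' ((w ∘ σ k) v) (k • w v)) := by
    intro v hv
    by_contra hcon
    refine absurd (Finset.mem_filter.1 hv).2 (not_le.2 (hK _ _ fun k hk => ?_))
    simp only [Finset.mem_biUnion, not_exists, not_and] at hcon
    have := hcon k hk
    simp only [Finset.mem_union, Finset.mem_filter, Finset.mem_univ, true_and, not_or, not_le,
      Function.comp_apply] at this
    obtain ⟨h1, h2⟩ := this
    have h3 := rhoInf_lt_iff.1 hzw (σ k v)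
    rw [h'.symmetric] at h1
    have h4 := h'.triangle (k • z v) (k • w v) (z (σ k v))
    have h5 := h'.triangle (z (σ k v)) (k • w v) (w (σ k v))
    linarith
  refine (Nat.cast_le.2 (Finset.card_le_card hsub)).trans ?_
  have hn0 : (0 : ℝ) ≤ Fintype.card D := by positivity
  refine (Finset.card_biUnion_le_mul_real K _ (a := 2 * r * Fintype.card D)
    fun k hk => ?_).trans (by nlinarith)
  have e1 := card_filter_le_of_rhoTwo_le hδ0.le (by positivity) hδr (hz k hk)
  have e2 := card_filter_le_of_rhoTwo_le hδ0.le (by positivity) hδr (hw k hk)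
  refine (Nat.cast_le.2 (Finset.card_union_le _ _)).trans ?_
  push_cast
  linarith

end ApproximateOrbits

/-! ### Independence of the pseudometric -/

section Independence

variable {M : Type uM} [Monoid M] {X : Type uX} [TopologicalSpace X] [CompactSpace X]
  [MulAction M X] [ContinuousConstSMul M X] {I : Type uI} [Preorder I] [IsDirectedOrder I]
  [Nonempty I] {S : SoficNet.{uM, uI, uD} M I} {ρ ρ' : X → X → ℝ}

/-- The order of quantifiers matters: `ε'` depends on `ε` but not on `η`, so `η` can later tend to
zero inside the supremum over scales. -/
lemma exists_entropyAux_le_add (hS : S.IsStrongSoficApproximation) (h : IsGenPseudometric M ρ)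
    (h' : IsGenPseudometric M ρ') {ε : ℝ} (hε : 0 < ε) :
    ∃ ε' : ℝ, 0 < ε' ∧ ∀ η : ℝ, 0 < η → ∀ (F' : Finset M) (δ' : ℝ), 0 < δ' →
      ∃ (F : Finset M) (δ : ℝ), 0 < δ ∧
        entropyAux S ρ ε F δ ≤ entropyAux S ρ' ε' F' δ' + (η : EReal) := by
  classical
  obtain ⟨K, κ, hκ, hK⟩ := h'.exists_finset_lt h.toIsContinuousPseudometric (half_pos hε)
  refine ⟨κ / 3, by positivity, fun η hη F' δ' hδ' => ?_⟩
  obtain ⟨θ, hθ, hsep⟩ :=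
    exists_sepNumber_rhoInf_le.{uX, uD} h.toIsContinuousPseudometric hε hη
  obtain ⟨δ₀, hδ₀, hclose⟩ :=
    exists_card_filter_le_of_rhoInf_lt.{uM, uX, uD} h'.toIsPseudometric hκ hK hθ
  -- Adding `K` and `δ₀` to the target makes `hclose` applicable; `F'` and `δ'` give the wanted
  -- model space.
  obtain ⟨F, δ, hδ, hsub⟩ := eventually_mapSet_subset hS h h'.toIsContinuousPseudometric
    (F' ∪ K) (lt_min hδ' hδ₀)
  refine ⟨F, δ, hδ, ?_⟩
  have hev : ∀ᶠ i in atTop,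
      ENNReal.log (sepNumber (mapSet ρ F δ (S.σ i)) (rhoInf (S.D i) ρ) ε : ENNReal) /
        (Fintype.card (S.D i) : EReal) ≤
      ENNReal.log (sepNumber (mapSet ρ' F' δ' (S.σ i)) (rhoInf (S.D i) ρ') (κ / 3) : ENNReal) /
        (Fintype.card (S.D i) : EReal) + (η : EReal) := by
    filter_upwards [hsub] with i hi
    have hc : (0 : ℝ) < Fintype.card (S.D i) := by exact_mod_cast Fintype.card_pos
    have h1 := hsep (S.D i) (mapSet ρ F δ (S.σ i)) ρ' (κ / 3) h'.toIsPseudometric (by positivity)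
      fun w hw z hz => hclose (S.D i) (S.σ i)
        w (mapSet_mono Finset.subset_union_right (min_le_right _ _) (hi hw))
        z (mapSet_mono Finset.subset_union_right (min_le_right _ _) (hi hz))
    have h2 : (sepNumber (mapSet ρ F δ (S.σ i)) (rhoInf (S.D i) ρ') (κ / 3) : ENNReal) ≤
        sepNumber (mapSet ρ' F' δ' (S.σ i)) (rhoInf (S.D i) ρ') (κ / 3) := by
      exact_mod_cast sepNumber_mono
        (hi.trans (mapSet_mono Finset.subset_union_left (min_le_left _ _)))
    have h3 := ENNReal.log_monotone (h1.trans (mul_le_mul_left h2 _))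
    rw [ENNReal.log_mul_add, ENNReal.log_ofReal_of_pos (Real.exp_pos _), Real.log_exp] at h3
    have hc' : (0 : EReal) ≤ (Fintype.card (S.D i) : EReal) := by positivity
    refine (EReal.div_le_div_right_of_nonneg hc' h3).trans_eq ?_
    rw [EReal.add_div_of_nonneg_right hc']
    congr 1
    rw [← EReal.coe_natCast, ← EReal.coe_div]
    congr 1
    field_simp
  refine (limsup_le_limsup hev).trans ?_
  -- The second summand is the finite constant `η`, which excludes the ambiguous sums of infinities.
  refine (EReal.limsup_add_le (.inr ?_) (.inr ?_)).trans_eq ?_ <;> simp [entropyAux]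

lemma relSoficEntropy_le (hS : S.IsStrongSoficApproximation) (h : IsGenPseudometric M ρ)
    (h' : IsGenPseudometric M ρ') : relSoficEntropy S ρ ≤ relSoficEntropy S ρ' := by
  refine iSup₂_le fun ε hε => ?_
  obtain ⟨ε', hε', hle⟩ := exists_entropyAux_le_add hS h h' hε
  refine le_trans ?_ (le_iSup₂ (f := fun (ε : ℝ) (_ : 0 < ε) =>
    ⨅ (F : Finset M), ⨅ (δ : ℝ) (_ : 0 < δ), entropyAux S ρ' ε F δ) ε' hε')
  refine le_iInf fun F' => le_iInf₂ fun δ' hδ' => EReal.le_of_forall_lt_iff_le.1 fun a ha => ?_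
  -- Entropies may be infinite, so the slack `η = a - b` is taken between real numbers above the
  -- right-hand side.
  obtain ⟨b, hb, hba⟩ := EReal.lt_iff_exists_real_btwn.1 ha
  obtain ⟨F, δ, hδ, hFδ⟩ := hle (a - b) (sub_pos.2 (EReal.coe_lt_coe_iff.1 hba)) F' δ' hδ'
  refine (iInf_le_of_le F (iInf₂_le δ hδ)).trans (hFδ.trans ?_)
  refine (add_le_add_left hb.le _).trans_eq ?_
  rw [← EReal.coe_add]
  congr 1
  ring

lemma relSoficEntropy_eq (hS : S.IsStrongSoficApproximation) (h : IsGenPseudometric M ρ)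
    (h' : IsGenPseudometric M ρ') : relSoficEntropy S ρ = relSoficEntropy S ρ' :=
  (relSoficEntropy_le hS h h').antisymm (relSoficEntropy_le hS h' h)

end Independence

/-! ### Invariance under conjugacy -/

section Conjugacy

variable {M : Type uM} [Monoid M] {X : Type uX} {Y : Type uY} [MulAction M X] [MulAction M Y]

lemma IsGenPseudometric.comap [TopologicalSpace X] [TopologicalSpace Y] {ρ : X → X → ℝ}
    (h : IsGenPseudometric M ρ) {g : Y → X} (hg : Continuous g) (hinj : Function.Injective g)
    (hequiv : ∀ (m : M) y, g (m • y) = m • g y) :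
    IsGenPseudometric M fun y y' => ρ (g y) (g y') where
  self_eq_zero _ := h.self_eq_zero _
  symmetric _ _ := h.symmetric _ _
  triangle _ _ _ := h.triangle _ _ _
  continuous := h.continuous.comp (by fun_prop : Continuous fun p : Y × Y => (g p.1, g p.2))
  generating y y' hne := by
    simpa only [hequiv] using h.generating _ _ (hinj.ne hne)

lemma sepNumber_comap_le {Z : Type*} {W : Type*} {d : Z → Z → ℝ} {ε : ℝ} {g : W → Z}
    (hg : Function.Injective g) {A : Set W} {B : Set Z} (hAB : Set.MapsTo g A B) :
    sepNumber A (fun x y => d (g x) (g y)) ε ≤ sepNumber B d ε := by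
  refine iSup_le fun T => iSup_le fun hTA => iSup_le fun hT => ?_
  rw [← hg.encard_image]
  refine le_iSup_of_le (g '' T) (le_iSup_of_le (hAB.mono_left hTA).image_subset
    (le_iSup_of_le ?_ le_rfl))
  rintro _ ⟨x, hx, rfl⟩ _ ⟨y, hy, rfl⟩ hne
  exact hT hx hy fun he => hne (he ▸ rfl)

/-- Composition with `g` preserves both distances on the powers and maps approximate orbits to
approximate orbits with the same `F` and `δ`; topology plays no role. -/
lemma relSoficEntropy_comap_le {I : Type uI} [Preorder I] (S : SoficNet.{uM, uI, uD} M I)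
    (ρ : X → X → ℝ) {g : Y → X} (hinj : Function.Injective g)
    (hequiv : ∀ (m : M) y, g (m • y) = m • g y) :
    relSoficEntropy S (fun y y' => ρ (g y) (g y')) ≤ relSoficEntropy S ρ := by
  refine iSup₂_mono fun ε _ => iInf_mono fun F => iInf₂_mono fun δ _ =>
    limsup_le_limsup (Eventually.of_forall fun i => ?_)
  refine EReal.div_le_div_right_of_nonneg (by positivity) (ENNReal.log_monotone ?_)
  have hmaps : Set.MapsTo (fun φ : S.D i → Y => g ∘ φ)
      (mapSet (fun y y' => ρ (g y) (g y')) F δ (S.σ i)) (mapSet ρ F δ (S.σ i)) := fun φ hφ m hm => by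
    simpa only [rhoTwo, Function.comp_apply, hequiv] using hφ m hm
  have hrho : rhoInf (S.D i) (fun y y' => ρ (g y) (g y')) =
      fun φ ψ => rhoInf (S.D i) ρ (g ∘ φ) (g ∘ ψ) := rfl
  have := sepNumber_comap_le (d := rhoInf (S.D i) ρ) (ε := ε) hinj.comp_left hmaps
  rw [← hrho] at this
  exact_mod_cast this

lemma relSoficEntropy_comap_equiv {I : Type uI} [Preorder I] (S : SoficNet.{uM, uI, uD} M I)
    (ρ : X → X → ℝ) (g : Y ≃ X) (hequiv : ∀ (m : M) y, g (m • y) = m • g y) :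
    relSoficEntropy S (fun y y' => ρ (g y) (g y')) = relSoficEntropy S ρ := by
  refine (relSoficEntropy_comap_le S ρ g.injective hequiv).antisymm ?_
  have := relSoficEntropy_comap_le S (fun y y' => ρ (g y) (g y')) g.symm.injective
    fun (m : M) x => by rw [Equiv.symm_apply_eq, hequiv, Equiv.apply_symm_apply]
  simpa only [Equiv.apply_symm_apply] using this

end Conjugacy

theorem mainTheorem4 {M : Type uM} [Monoid M] [Infinite M] (hM : StronglySofic M)
    {X : Type uX} [TopologicalSpace X] [CompactSpace X] [MulAction M X] [ContinuousConstSMul M X]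
    {Y : Type uY} [TopologicalSpace Y] [CompactSpace Y] [MulAction M Y] [ContinuousConstSMul M Y]
    (hconj : TopologicallyConjugate M X Y) (hX : AdmitsGenPseudometric M X) :
    ∃ hY : AdmitsGenPseudometric M Y,
      ∀ {I : Type uI} [Preorder I] [IsDirectedOrder I] [Nonempty I]
        (S : SoficNet.{uM, uI, uD} M I), S.IsStrongSoficApproximation →
        (∀ ρ : X → X → ℝ, IsGenPseudometric M ρ → relSoficEntropy S ρ = soficEntropy S hX) ∧
        (∀ ρ : Y → Y → ℝ, IsGenPseudometric M ρ → relSoficEntropy S ρ = soficEntropy S hY) ∧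
        soficEntropy S hX = soficEntropy S hY := by

  obtain ⟨f, hf⟩ := hconj
  have hf' : ∀ (m : M) y, f.symm.toEquiv (m • y) = m • f.symm.toEquiv y := fun m y =>
    f.injective (by simp [hf])
  have hρY := hX.choose_spec.comap f.symm.continuous f.symm.injective hf'
  refine ⟨⟨_, hρY⟩, fun {I} _ _ _ S hS => ⟨fun ρ hρ => relSoficEntropy_eq hS hρ hX.choose_spec,
    fun ρ hρ => relSoficEntropy_eq hS hρ (Exists.choose_spec _), ?_⟩⟩
  -- The pseudometric chosen for `Y` need not be the transported one, so independence on `Y` closes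
  -- the gap.
  exact (relSoficEntropy_comap_equiv S hX.choose f.symm.toEquiv hf').symm.trans
    (relSoficEntropy_eq hS hρY (Exists.choose_spec _))
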